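/- Let $P_0$ be a probability measure on $\mathbb R^d$, $Z(\beta)=\int e^{\beta\cdot x}\,dP_0(x)$, $\Gamma=\{\beta\in\mathbb R^d : Z(\beta)<\infty\}$, and assume that $\Gamma$ has an interior point. The exponential family based on $P_0$ consists of the probability measures $P_\beta$, $\beta\in\Gamma$, with density $p_\beta(x)=e^{\beta\cdot x}/Z(\beta)$ with respect to $P_0$. For a finite sequence $x^n=(x_1,\dots,x_n)$ put $p_\beta(x^n)=\prod_{i\le n}p_\beta(x_i)$. An exponential prediction system $Q$ for this family is given by a prior measure $\eta$ on $\Gamma$, possibly improper. The system is defined at a finite (perhaps empty) sequence $x^m$ of points of the support of $P_0$ when $0<\int_\Gamma p_\beta(x^m)\,d\eta(\beta)<\infty$, and we require that it is defined at at least one such sequence. Where it is defined, the prediction $Q(\cdot\mid x^m)$ of the next outcome is the probability measure with $P_0$-density $$q(x\mid x^m)=\int_\Gamma p_\beta(x)\,\frac{p_\beta(x^m)}{\int_\Gamma p_\gamma(x^m)\,d\eta(\gamma)}\,d\eta(\beta).$$ Two systems are different if the partial maps $x^m\mapsto Q(\cdot\mid x^m)$ are different. For $n\ge m$ let $Q(x^n\mid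 x^m)=\prod_{i=m}^{n-1}q(x_{i+1}\mid x^i)$. The conditional regret of $Q$ is $$\mathrm{REG}_Q(x^n\mid x^m)=-\ln Q(x^n\mid x^m)-\Bigl(-\ln \sup_{\beta\in\Gamma}p_\beta(x^n)\Bigr),$$ where the supremum is the density of $x^n$ under its maximum likelihood distribution in the family, if that exists. **Theorem.** Let $Q_1$ and $Q_2$ be two different exponential prediction systems for the same exponential family. Then there are a sequence $x_1,x_2,\dots$ in $\mathbb R^d$ and a number $m\ge 0$ such that, for every $n\ge m$, both systems are defined at $x^n$ and a maximum likelihood distribution for $x^n$ exists in the family, and $$\liminf_{n\to\infty}\bigl(\mathrm{REG}_{Q_2}(x^n\mid x^m)-\mathrm{REG}_{Q_1}(x^n\mid x^m)\bigr)>0,$$ where the value $+\infty$ of the limit inferior is allowed. (By symmetry the same holds with $Q_1$ and $Q_2$ exchanged.) -/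

import Mathlib

open MeasureTheory Filter
open scoped ENNReal

namespace ExpFamily

noncomputable section

/-- The sample and parameter vectors: `ℝ^d` with its scalar product. -/
abbrev Vec (d : ℕ) : Type := EuclideanSpace ℝ (Fin d)

/-- The partition function `Z(β) = ∫ exp(β x) dP₀(x)`. -/
def partitionFn {d : ℕ} (P₀ : Measure (Vec d)) (β : Vec d) : ℝ≥0∞ :=
  ∫⁻ x, ENNReal.ofReal (Real.exp (inner ℝ β x)) ∂P₀

/-- The canonical parameter space `Γ = {β | Z(β) < ∞}`. -/
def canonicalSpace {d : ℕ} (P₀ : Measure (Vec d)) : Set (Vec d) :=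
  {β | partitionFn P₀ β < ∞}

/-- The density `dP_β/dP₀ (x) = exp(β x) / Z(β)` of the element `P_β` of the exponential family. -/
def density {d : ℕ} (P₀ : Measure (Vec d)) (β x : Vec d) : ℝ :=
  Real.exp (inner ℝ β x) / (partitionFn P₀ β).toReal

/-- The density `P_β(x₁) ⋯ P_β(x_n)` of a finite sequence of independent outcomes under `P_β`. -/
def likelihood {d : ℕ} (P₀ : Measure (Vec d)) (β : Vec d) (l : List (Vec d)) : ℝ :=
  (l.map (density P₀ β)).prod

/-- The prior integral `∫ P_β(x₁) ⋯ P_β(x_m) dη(β)` of a (possibly improper) prior `η`. -/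
def priorIntegral {d : ℕ} (P₀ η : Measure (Vec d)) (l : List (Vec d)) : ℝ≥0∞ :=
  ∫⁻ β, ENNReal.ofReal (likelihood P₀ β l) ∂η

/-- The posterior can be formed after the outcomes `l`: these are possible outcomes
(points of the support of `P₀`), and the prior integral can be normalized. -/
def Conditionable {d : ℕ} (P₀ η : Measure (Vec d)) (l : List (Vec d)) : Prop :=
  (∀ x ∈ l, x ∈ P₀.support) ∧ 0 < priorIntegral P₀ η l ∧ priorIntegral P₀ η l < ∞

/-- The posterior distribution of the parameter, given the outcomes `l`. -/
def posterior {d : ℕ} (P₀ η : Measure (Vec d)) (l : List (Vec d)) : Measure (Vec d) :=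
  (priorIntegral P₀ η l)⁻¹ • η.withDensity (fun β => ENNReal.ofReal (likelihood P₀ β l))

/-- The density with respect to `P₀` of the prediction of the next outcome, given `l`:
the mixture of the densities of the family under the posterior. -/
def predictiveDensity {d : ℕ} (P₀ η : Measure (Vec d)) (l : List (Vec d)) (x : Vec d) : ℝ≥0∞ :=
  ∫⁻ β, ENNReal.ofReal (density P₀ β x) ∂(posterior P₀ η l)

/-- An exponential prediction system for the exponential family based on `P₀`. It is given by a
prior measure on the parameters of the family, not necessarily finite, for which the posterior
exists after at least one finite (perhaps empty) sequence of outcomes. -/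
structure PredictionSystem {d : ℕ} (P₀ : Measure (Vec d)) where
  prior : Measure (Vec d)
  prior_compl : prior (canonicalSpace P₀)ᶜ = 0
  exists_conditionable : ∃ l, Conditionable P₀ prior l

namespace PredictionSystem

variable {d : ℕ} {P₀ : Measure (Vec d)}

/-- The partial map `x^m ↦ Q(· | x^m)` from finite sequences of outcomes to distributions of the
next outcome. It is defined exactly where the posterior exists. -/
def predict (Q : PredictionSystem P₀) : List (Vec d) →. Measure (Vec d) := fun l =>
  ⟨Conditionable P₀ Q.prior l, fun _ => P₀.withDensity (predictiveDensity P₀ Q.prior l)⟩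

end PredictionSystem

/-- The initial segment `x^n` of an infinite sequence; its terms are `x 0, …, x (n - 1)`. -/
def initialSegment {d : ℕ} (x : ℕ → Vec d) (n : ℕ) : List (Vec d) :=
  (List.range n).map x

/-- The density `Q(x^n | x^m)` with respect to `P₀`: by consistency, the product of the densities
of the successive predictions of the terms of `x^n` that follow `x^m`. -/
def condDensity {d : ℕ} {P₀ : Measure (Vec d)} (Q : PredictionSystem P₀) (x : ℕ → Vec d)
    (m n : ℕ) : ℝ :=
  ∏ i ∈ Finset.Ico m n, (predictiveDensity P₀ Q.prior (initialSegment x i) (x i)).toReal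

/-- `P_β` is a maximum likelihood distribution for the outcomes `l`: the optimal element of the
exponential family, written `P^{x̄}` where `x̄` is the average of `l`. -/
def IsMaxLikelihood {d : ℕ} (P₀ : Measure (Vec d)) (l : List (Vec d)) (β : Vec d) : Prop :=
  β ∈ canonicalSpace P₀ ∧ ∀ β' ∈ canonicalSpace P₀, likelihood P₀ β' l ≤ likelihood P₀ β l

/-- The logarithm `ln P^{x̄}(l)` of the largest density that the exponential family gives to `l`.
If a maximum likelihood distribution exists then this is the logarithm of its density. -/
def maxLogLikelihood {d : ℕ} (P₀ : Measure (Vec d)) (l : List (Vec d)) : ℝ :=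
  sSup ((fun β => Real.log (likelihood P₀ β l)) '' canonicalSpace P₀)

/-- The conditional regret `REG_Q(x^n | x^m) = - ln Q(x^n | x^m) - (- ln P^{x̄}(x^n))`. -/
def regret {d : ℕ} {P₀ : Measure (Vec d)} (Q : PredictionSystem P₀) (x : ℕ → Vec d)
    (m n : ℕ) : ℝ :=
  -Real.log (condDensity Q x m n) - (-maxLogLikelihood P₀ (initialSegment x n))

end

end ExpFamily

/-! The maximum likelihood term cancels from the difference of the regrets, leaving the sum of
ln(q₁/q₂) over the successive outcomes. Both predictive densities have P₀-integral 1, so after any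
sequence where both systems are defined some support point has q₂ ≤ q₁
(`exists_predictiveDensity_le`). Continuing with such points makes every term nonnegative, and one
strict inequality then keeps the difference away from 0.

A strict step is missing only if q₁ ≤ q₂ on the support after all extensions of a common starting
sequence a, so that q₁ = q₂ almost everywhere after each of them. Then the systems coincide
(`PredictionSystem.predict_eq`): repeated prediction determines the posterior expectation of every
product P_β(B₁)⋯P_β(B_k), and these moments determine the joint law of countably many such
probabilities (`measure_ext_of_moments`). Densities at support points are limits of
P_β(ball)/P₀(ball), so the prior integrals of all sequences in the support agree up to one factor.
The posteriors themselves need not agree, since different β may give the same distribution.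

The sequence a joins one sequence at which each system is defined with one that affinely spans the
support (`exists_common_conditionable`). A spanning sequence has a maximum likelihood distribution,
so its likelihood is bounded in β and appending it keeps prior integrals finite. -/

namespace ExpFamily

open scoped Topology

/-! ### Densities and likelihoods -/

section Basic

variable {d : ℕ} {P₀ : Measure (Vec d)}

lemma measurable_partitionFn [SFinite P₀] : Measurable (partitionFn P₀) := by
  unfold partitionFn
  refine Measurable.lintegral_prod_right' (f := fun p : Vec d × Vec d =>
    ENNReal.ofReal (Real.exp (inner ℝ p.1 p.2))) ?_
  fun_prop

lemma measurable_density [SFinite P₀] :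
    Measurable fun p : Vec d × Vec d => density P₀ p.1 p.2 := by
  have := measurable_partitionFn (P₀ := P₀)
  unfold density
  fun_prop

lemma measurable_density_param [SFinite P₀] (x : Vec d) :
    Measurable fun β => density P₀ β x :=
  measurable_density.comp (measurable_id.prodMk measurable_const)

lemma continuous_density (β : Vec d) : Continuous (density P₀ β) := by
  unfold density
  fun_prop

lemma measurable_likelihood [SFinite P₀] (l : List (Vec d)) :
    Measurable fun β => likelihood P₀ β l := by
  induction l with
  | nil => simp [likelihood]
  | cons x l ih =>
    simp only [likelihood, List.map_cons, List.prod_cons] at ih ⊢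
    exact (measurable_density_param x).mul ih

lemma partitionFn_pos [NeZero P₀] (β : Vec d) : 0 < partitionFn P₀ β := by
  unfold partitionFn
  rw [lintegral_pos_iff_support (by fun_prop)]
  have : Function.support (fun x => ENNReal.ofReal (Real.exp (inner ℝ β x))) = Set.univ := by
    ext x
    simp [Real.exp_pos]
  rw [this]
  exact NeZero.pos _

lemma density_nonneg (β x : Vec d) : 0 ≤ density P₀ β x := by
  unfold density
  positivity

lemma density_pos [NeZero P₀] {β : Vec d} (hβ : β ∈ canonicalSpace P₀) (x : Vec d) :
    0 < density P₀ β x :=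
  div_pos (Real.exp_pos _) (ENNReal.toReal_pos (partitionFn_pos β).ne' hβ.ne)

lemma likelihood_nonneg (β : Vec d) (l : List (Vec d)) : 0 ≤ likelihood P₀ β l := by
  refine List.prod_nonneg ?_
  simp only [List.mem_map]
  rintro _ ⟨x, -, rfl⟩
  exact density_nonneg β x

lemma likelihood_pos [NeZero P₀] {β : Vec d} (hβ : β ∈ canonicalSpace P₀) (l : List (Vec d)) :
    0 < likelihood P₀ β l := by
  refine List.prod_pos ?_
  simp only [List.mem_map]
  rintro _ ⟨x, -, rfl⟩
  exact density_pos hβ x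

lemma likelihood_append (β : Vec d) (a b : List (Vec d)) :
    likelihood P₀ β (a ++ b) = likelihood P₀ β a * likelihood P₀ β b := by
  simp [likelihood]

lemma likelihood_perm (β : Vec d) {a b : List (Vec d)} (h : a.Perm b) :
    likelihood P₀ β a = likelihood P₀ β b :=
  (h.map _).prod_eq

lemma likelihood_eq (β : Vec d) (l : List (Vec d)) :
    likelihood P₀ β l = Real.exp (inner ℝ β l.sum) / (partitionFn P₀ β).toReal ^ l.length := by
  induction l with
  | nil => simp [likelihood]
  | cons x l ih =>
    have : likelihood P₀ β (x :: l) = density P₀ β x * likelihood P₀ β l := by simp [likelihood]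
    rw [this, ih, density, List.sum_cons, inner_add_right, Real.exp_add, List.length_cons, pow_succ]
    ring

lemma lintegral_density [NeZero P₀] {β : Vec d} (hβ : β ∈ canonicalSpace P₀) :
    ∫⁻ x, ENNReal.ofReal (density P₀ β x) ∂P₀ = 1 := by
  have hZ := partitionFn_pos (P₀ := P₀) β
  have h : ∀ x, ENNReal.ofReal (density P₀ β x) =
      ENNReal.ofReal (Real.exp (inner ℝ β x)) * (partitionFn P₀ β)⁻¹ := by
    intro x
    rw [density, ENNReal.ofReal_div_of_pos (ENNReal.toReal_pos hZ.ne' hβ.ne),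
      ENNReal.ofReal_toReal hβ.ne, div_eq_mul_inv]
  simp_rw [h]
  rw [lintegral_mul_const _ (by fun_prop)]
  exact ENNReal.mul_inv_cancel hZ.ne' hβ.ne

lemma zero_mem_canonicalSpace [IsFiniteMeasure P₀] : (0 : Vec d) ∈ canonicalSpace P₀ := by
  simp [canonicalSpace, partitionFn]

end Basic

/-! ### Existence of maximum likelihood distributions -/

section MaxLikelihood

variable {d : ℕ} {P₀ : Measure (Vec d)}

/-- The partition function of the family translated by `-c`. -/
noncomputable def centeredPartitionFn (P₀ : Measure (Vec d)) (c β : Vec d) : ℝ≥0∞ :=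
  ∫⁻ y, ENNReal.ofReal (Real.exp (inner ℝ β (y - c))) ∂P₀

lemma partitionFn_eq_mul_centeredPartitionFn (c β : Vec d) :
    partitionFn P₀ β = ENNReal.ofReal (Real.exp (inner ℝ β c)) * centeredPartitionFn P₀ c β := by
  unfold partitionFn centeredPartitionFn
  rw [← lintegral_const_mul _ (by fun_prop)]
  refine lintegral_congr fun y => ?_
  rw [← ENNReal.ofReal_mul (Real.exp_pos _).le, ← Real.exp_add, inner_sub_right]
  congr 2
  ring

/-- Fatou's lemma. Continuity can fail at the boundary of Γ, but a minimum on a compact set needs no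
more than this. -/
lemma lowerSemicontinuous_centeredPartitionFn (c : Vec d) :
    LowerSemicontinuous (centeredPartitionFn P₀ c) := by
  rw [lowerSemicontinuous_iff_isClosed_preimage]
  intro t
  refine IsSeqClosed.isClosed fun u β hu hβ => ?_
  simp only [Set.mem_preimage, Set.mem_Iic, centeredPartitionFn] at hu ⊢
  calc ∫⁻ y, ENNReal.ofReal (Real.exp (inner ℝ β (y - c))) ∂P₀
      = ∫⁻ y, liminf (fun k => ENNReal.ofReal (Real.exp (inner ℝ (u k) (y - c)))) atTop ∂P₀ := by
        refine lintegral_congr fun y => (Tendsto.liminf_eq ?_).symm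
        exact ((ENNReal.continuous_ofReal.comp (Real.continuous_exp.comp
          (by fun_prop : Continuous fun γ : Vec d => inner ℝ γ (y - c)))).tendsto β).comp hβ
    _ ≤ liminf (fun k => ∫⁻ y, ENNReal.ofReal (Real.exp (inner ℝ (u k) (y - c))) ∂P₀) atTop :=
        lintegral_liminf_le fun k => by fun_prop
    _ ≤ t := liminf_le_of_frequently_le' (Frequently.of_forall hu)

/-- A nonempty list of points of the support that affinely spans the support. -/
structure Spanning (P₀ : Measure (Vec d)) (l : List (Vec d)) : Prop where
  ne_nil : l ≠ []
  mem_support : ∀ x ∈ l, x ∈ P₀.support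
  inner_eq_zero : ∀ u : Vec d, (∀ y ∈ l, ∀ y' ∈ l, inner ℝ u (y - y') = 0) →
    ∀ y ∈ P₀.support, ∀ y' ∈ P₀.support, inner ℝ u (y - y') = 0

lemma Spanning.mono {a b : List (Vec d)} (h : Spanning P₀ a) (hab : a ⊆ b)
    (hb : ∀ x ∈ b, x ∈ P₀.support) : Spanning P₀ b where
  ne_nil := by
    rintro rfl
    exact h.ne_nil (List.subset_nil.1 hab)
  mem_support := hb
  inner_eq_zero u hu := h.inner_eq_zero u fun y hy y' hy' => hu y (hab hy) y' (hab hy')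

/-- In finite dimension, finitely many differences y - x₀ span all of them. -/
lemma exists_spanning [NeZero P₀] : ∃ l, Spanning P₀ l := by
  obtain ⟨x₀, hx₀⟩ : P₀.support.Nonempty := by
    have := Measure.nonempty_inter_support_of_pos (μ := P₀) (s := Set.univ) (NeZero.pos _)
    simpa using this
  obtain ⟨s, hs, hspan⟩ := (Submodule.fg_span_iff_fg_span_finset_subset (R := ℝ)
    ((fun y => y - x₀) '' P₀.support)).1 (IsNoetherian.noetherian _)
  have hs' : ∀ v ∈ s, v + x₀ ∈ P₀.support := by
    intro v hv
    obtain ⟨y, hy, rfl⟩ := hs hv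
    simpa using hy
  refine ⟨x₀ :: s.toList.map (· + x₀), by simp, ?_, ?_⟩
  · intro x hx
    simp only [List.mem_cons, List.mem_map, Finset.mem_toList] at hx
    rcases hx with rfl | ⟨v, hv, rfl⟩
    · exact hx₀
    · exact hs' v hv
  · intro u hu
    have key : ∀ w ∈ Submodule.span ℝ (s : Set (Vec d)), inner ℝ u w = 0 := by
      intro w hw
      induction hw using Submodule.span_induction with
      | mem v hv =>
        have := hu (v + x₀) (by simp; right; exact hv) x₀ (by simp)
        simpa using this
      | zero => simp
      | add a b _ _ ha hb => rw [inner_add_right, ha, hb, add_zero]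
      | smul r a _ ha => rw [inner_smul_right, ha, mul_zero]
    have key' : ∀ y ∈ P₀.support, inner ℝ u (y - x₀) = 0 := fun y hy =>
      key _ (hspan ▸ Submodule.subset_span ⟨y, hy, rfl⟩)
    intro y hy y' hy'
    rw [← sub_sub_sub_cancel_right y y' x₀, inner_sub_right, key' y hy, key' y' hy', sub_zero]

/-- The average of a list. -/
noncomputable def average (l : List (Vec d)) : Vec d := (l.length : ℝ)⁻¹ • l.sum

lemma sum_inner_sub_average (l : List (Vec d)) (hl : l ≠ []) (u : Vec d) :
    (l.map fun y => inner ℝ u (y - average l)).sum = 0 := by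
  have h : ∀ (c : Vec d) (a : List (Vec d)),
      (a.map fun y => inner ℝ u (y - c)).sum = inner ℝ u a.sum - a.length * inner ℝ u c := by
    intro c a
    induction a with
    | nil => simp
    | cons x a ih =>
      rw [List.map_cons, List.sum_cons, ih, inner_sub_right, List.sum_cons, inner_add_right,
        List.length_cons]
      push_cast
      ring
  rw [h, average, inner_smul_right, mul_inv_cancel_left₀, sub_self]
  simpa using hl

/-- The average lies in the relative interior of the convex hull of the list; compactness of the
unit sphere of the span makes this uniform. -/
lemma exists_pos_le_inner_sub_average {l : List (Vec d)} (hl : l ≠ []) :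
    ∃ ε > 0, ∀ u ∈ Submodule.span ℝ {v | ∃ y ∈ l, ∃ y' ∈ l, v = y - y'},
      ∃ y ∈ l, ε * ‖u‖ ≤ inner ℝ u (y - average l) := by
  set W := Submodule.span ℝ {v : Vec d | ∃ y ∈ l, ∃ y' ∈ l, v = y - y'} with hW
  set N : Vec d → ℝ := fun u => ∑ y ∈ l.toFinset, max 0 (inner ℝ u (y - average l)) with hN
  have hpos : ∀ u ∈ Metric.sphere (0 : Vec d) 1 ∩ W, 0 < N u := by
    rintro u ⟨hu1, huW⟩
    by_contra hcon
    have h0 : ∀ y ∈ l, inner ℝ u (y - average l) ≤ 0 := by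
      intro y hy
      have h1 := Finset.single_le_sum (f := fun y => max 0 (inner ℝ u (y - average l)))
        (fun _ _ => le_max_left _ _) (List.mem_toFinset.2 hy)
      exact (le_max_right _ _).trans (h1.trans (not_lt.1 hcon))
    -- Nonpositive numbers with sum 0 all vanish, so u is orthogonal to W as well as in it.
    have h2 : ∀ y ∈ l, inner ℝ u (y - average l) = 0 := by
      have hs := sum_inner_sub_average l hl u
      intro y hy
      by_contra hy0
      have hlt := List.sum_lt_sum (fun y => inner ℝ u (y - average l)) (fun _ => (0 : ℝ)) h0
        ⟨y, hy, lt_of_le_of_ne (h0 y hy) hy0⟩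
      simp [hs] at hlt
    have h3 : ∀ w ∈ W, inner ℝ u w = 0 := by
      intro w hw
      induction hw using Submodule.span_induction with
      | mem v hv =>
        obtain ⟨y, hy, y', hy', rfl⟩ := hv
        rw [← sub_sub_sub_cancel_right y y' (average l), inner_sub_right, h2 y hy, h2 y' hy',
          sub_zero]
      | zero => simp
      | add a b _ _ ha hb => rw [inner_add_right, ha, hb, add_zero]
      | smul r a _ ha => rw [inner_smul_right, ha, mul_zero]
    have : u = 0 := inner_self_eq_zero.1 (h3 u huW)
    simp [this] at hu1
  have hcont : Continuous N := by
    rw [hN]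
    fun_prop
  obtain ⟨t, ht, hN'⟩ := ((isCompact_sphere (0 : Vec d) 1).inter_right
    (Submodule.closed_of_finiteDimensional W)).exists_forall_le' hcont.continuousOn hpos
  have hcard : 0 < (l.toFinset.card : ℝ) := by
    simpa [Finset.card_pos] using hl
  -- The positive parts sum to at least t on the unit sphere of W, so one of them is at least this.
  refine ⟨t / l.toFinset.card, by positivity, fun u hu => ?_⟩
  by_cases hu0 : u = 0
  · obtain ⟨y, hy⟩ := List.exists_mem_of_ne_nil l hl
    exact ⟨y, hy, by simp [hu0]⟩
  have hnu : 0 < ‖u‖ := norm_pos_iff.2 hu0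
  have h4 := hN' (‖u‖⁻¹ • u) ⟨by simp [norm_smul, hnu.ne'], W.smul_mem _ hu⟩
  have h5 : ∑ y ∈ l.toFinset, t / l.toFinset.card ≤ N (‖u‖⁻¹ • u) := by
    rw [Finset.sum_const, nsmul_eq_mul, mul_div_cancel₀ _ hcard.ne']
    exact h4
  obtain ⟨y, hy, hle⟩ := Finset.exists_le_of_sum_le (by simpa using hl) h5
  refine ⟨y, List.mem_toFinset.1 hy, ?_⟩
  have h6 : t / l.toFinset.card ≤ inner ℝ (‖u‖⁻¹ • u) (y - average l) := by
    rcases le_max_iff.1 hle with h | h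
    · exact absurd h (not_le.2 (by positivity))
    · exact h
  rw [real_inner_smul_left, inv_mul_eq_div, le_div_iff₀ hnu] at h6
  exact h6

/-- For each β in the span some listed point has exponent at least ε‖β‖. On the ball of radius ε/2
about it, which has positive mass, the exponent is still at least (ε/2)‖β‖. -/
lemma Spanning.exists_one_le_centeredPartitionFn [IsFiniteMeasure P₀] {l : List (Vec d)}
    (h : Spanning P₀ l) :
    ∃ R : ℝ, 0 ≤ R ∧ ∀ β ∈ Submodule.span ℝ {v | ∃ y ∈ l, ∃ y' ∈ l, v = y - y'}, R ≤ ‖β‖ →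
      1 ≤ centeredPartitionFn P₀ (average l) β := by
  obtain ⟨ε, hε, hl⟩ := exists_pos_le_inner_sub_average h.ne_nil
  obtain ⟨y₀, hy₀, hmin⟩ := Finset.exists_min_image l.toFinset
    (fun y => P₀ (Metric.ball y (ε / 2))) (by simpa using h.ne_nil)
  have hp : 0 < P₀.real (Metric.ball y₀ (ε / 2)) :=
    ENNReal.toReal_pos ((Measure.mem_support_iff_forall _).1
      (h.mem_support _ (List.mem_toFinset.1 hy₀)) _ (Metric.ball_mem_nhds _ (by positivity))).ne'
      (measure_ne_top _ _)
  set p := P₀.real (Metric.ball y₀ (ε / 2)) with hp_def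
  -- Chosen so that (1 + (ε/2)‖β‖) p ≥ 1; p is the least mass of the balls.
  refine ⟨2 / (ε * p), by positivity, fun β hβ hR => ?_⟩
  obtain ⟨y, hy, hle⟩ := hl β hβ
  have hexp : 1 ≤ Real.exp (ε / 2 * ‖β‖) * p := by
    rw [div_le_iff₀ (by positivity)] at hR
    have := Real.add_one_le_exp (ε / 2 * ‖β‖)
    nlinarith
  calc (1 : ℝ≥0∞) ≤ ENNReal.ofReal (Real.exp (ε / 2 * ‖β‖) * p) := by
        rw [← ENNReal.ofReal_one]
        exact ENNReal.ofReal_le_ofReal hexp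
    _ = ENNReal.ofReal (Real.exp (ε / 2 * ‖β‖)) * P₀ (Metric.ball y₀ (ε / 2)) := by
        rw [ENNReal.ofReal_mul (Real.exp_pos _).le, hp_def, Measure.real,
          ENNReal.ofReal_toReal (measure_ne_top _ _)]
    _ ≤ ENNReal.ofReal (Real.exp (ε / 2 * ‖β‖)) * P₀ (Metric.ball y (ε / 2)) := by
        exact mul_le_mul' le_rfl (hmin y (List.mem_toFinset.2 hy))
    _ = ∫⁻ _ in Metric.ball y (ε / 2), ENNReal.ofReal (Real.exp (ε / 2 * ‖β‖)) ∂P₀ := by simp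
    _ ≤ ∫⁻ z in Metric.ball y (ε / 2),
          ENNReal.ofReal (Real.exp (inner ℝ β (z - average l))) ∂P₀ := by
        refine setLIntegral_mono' measurableSet_ball fun z hz => ?_
        gcongr
        have h1 : inner ℝ β (z - average l) = inner ℝ β (y - average l) - inner ℝ β (y - z) := by
          rw [← inner_sub_right]
          congr 1
          abel
        have h2 : inner ℝ β (y - z) ≤ ‖β‖ * (ε / 2) := by
          refine (real_inner_le_norm _ _).trans ?_
          gcongr
          rw [← dist_eq_norm, dist_comm]
          exact (Metric.mem_ball.1 hz).le
        linarith
    _ ≤ centeredPartitionFn P₀ (average l) β := setLIntegral_le_lintegral _ _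

lemma average_inner_sub (l : List (Vec d)) (hl : l ≠ []) (u x₀ : Vec d)
    (hu : ∀ y ∈ l, inner ℝ u (y - x₀) = 0) : inner ℝ u (average l - x₀) = 0 := by
  have h := sum_inner_sub_average l hl u
  have h1 : (l.map fun y => inner ℝ u (y - average l)) =
      l.map fun _ => -inner ℝ u (average l - x₀) := by
    refine List.map_congr_left fun y hy => ?_
    rw [← sub_sub_sub_cancel_right y _ x₀, inner_sub_right, hu y hy, zero_sub]
  rw [h1] at h
  simpa [hl] using h

/-- The centered partition function attains its minimum. -/
lemma Spanning.exists_forall_centeredPartitionFn_le [IsProbabilityMeasure P₀] {l : List (Vec d)}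
    (h : Spanning P₀ l) :
    ∃ β, ∀ β', centeredPartitionFn P₀ (average l) β ≤ centeredPartitionFn P₀ (average l) β' := by
  set W := Submodule.span ℝ {v : Vec d | ∃ y ∈ l, ∃ y' ∈ l, v = y - y'} with hW
  obtain ⟨R, hR0, hR⟩ := h.exists_one_le_centeredPartitionFn
  have hK : IsCompact (Metric.closedBall (0 : Vec d) R ∩ W) :=
    (isCompact_closedBall _ _).inter_right (Submodule.closed_of_finiteDimensional W)
  have h0 : (0 : Vec d) ∈ Metric.closedBall (0 : Vec d) R ∩ W := ⟨by simpa using hR0, W.zero_mem⟩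
  obtain ⟨β, -, hmin⟩ := LowerSemicontinuousOn.exists_isMinOn ⟨0, h0⟩ hK
    ((lowerSemicontinuous_centeredPartitionFn (P₀ := P₀) (average l)).lowerSemicontinuousOn _)
  rw [isMinOn_iff] at hmin
  have hone : centeredPartitionFn P₀ (average l) 0 = 1 := by simp [centeredPartitionFn]
  refine ⟨β, fun β' => ?_⟩
  -- The component of β' orthogonal to W does not affect the exponent on the support, so minimizing
  -- over W suffices. Outside the ball of radius R the value is at least 1, the value at 0.
  set w : Vec d := W.starProjection β' with hw
  have hwW : w ∈ W := Submodule.starProjection_apply_mem _ _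
  have hle : centeredPartitionFn P₀ (average l) β ≤ centeredPartitionFn P₀ (average l) w := by
    rcases le_total ‖w‖ R with hwR | hwR
    · exact hmin w ⟨by simpa using hwR, hwW⟩
    · exact (hmin 0 h0).trans (hone.le.trans (hR w hwW hwR))
  refine hle.trans_eq (lintegral_congr_ae ?_)
  have horth : β' - w ∈ Wᗮ := Submodule.sub_starProjection_mem_orthogonal _
  have hzero : ∀ y ∈ l, ∀ y' ∈ l, inner ℝ (β' - w) (y - y') = 0 := fun y hy y' hy' =>
    Submodule.inner_left_of_mem_orthogonal (Submodule.subset_span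
      (s := {v : Vec d | ∃ y ∈ l, ∃ y' ∈ l, v = y - y'}) ⟨y, hy, y', hy', rfl⟩) horth
  filter_upwards [Measure.support_mem_ae (μ := P₀)] with x hx
  have h1 : inner ℝ (β' - w) (average l - x) = 0 :=
    average_inner_sub l h.ne_nil _ _ fun y hy =>
      h.inner_eq_zero _ hzero y (h.mem_support y hy) x hx
  have h2 : inner ℝ β' (x - average l) = inner ℝ w (x - average l) := by
    rw [inner_sub_left] at h1
    rw [← neg_sub, inner_neg_right, inner_neg_right]
    linarith
  rw [h2]

/-- A maximum likelihood distribution exists for lists that affinely span the support. -/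
theorem Spanning.exists_isMaxLikelihood [IsProbabilityMeasure P₀] {l : List (Vec d)}
    (h : Spanning P₀ l) : ∃ β, IsMaxLikelihood P₀ l β := by
  obtain ⟨β, hβ⟩ := h.exists_forall_centeredPartitionFn_le
  have hn : (l.length : ℝ) ≠ 0 := by simpa using h.ne_nil
  have hfin : ∀ γ, γ ∈ canonicalSpace P₀ ↔ centeredPartitionFn P₀ (average l) γ < ∞ := by
    intro γ
    have he : ENNReal.ofReal (Real.exp (inner ℝ γ (average l))) ≠ 0 := by simp [Real.exp_pos]
    simp only [canonicalSpace, Set.mem_ofPred_eq, partitionFn_eq_mul_centeredPartitionFn (average l)]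
    constructor
    · intro hlt
      by_contra hcon
      rw [not_lt, top_le_iff] at hcon
      rw [hcon, ENNReal.mul_top he] at hlt
      exact lt_irrefl _ hlt
    · exact ENNReal.mul_lt_top ENNReal.ofReal_lt_top
  -- Centering at the average absorbs the exponential, so maximizing the likelihood is minimizing
  -- the centered partition function.
  have hlik : ∀ γ, likelihood P₀ γ l =
      ((centeredPartitionFn P₀ (average l) γ).toReal ^ l.length)⁻¹ := by
    intro γ
    rw [likelihood_eq, partitionFn_eq_mul_centeredPartitionFn (average l), ENNReal.toReal_mul,
      ENNReal.toReal_ofReal (Real.exp_pos _).le, mul_pow, ← Real.exp_nat_mul]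
    have : (l.length : ℝ) * inner ℝ γ (average l) = inner ℝ γ l.sum := by
      rw [average, inner_smul_right, mul_inv_cancel_left₀ hn]
    rw [this, div_mul_eq_div_div, div_self (Real.exp_pos _).ne', one_div]
  have hβfin : centeredPartitionFn P₀ (average l) β < ∞ :=
    (hβ 0).trans_lt ((hfin 0).1 zero_mem_canonicalSpace)
  have hβΓ := (hfin β).2 hβfin
  refine ⟨β, hβΓ, fun β' hβ' => ?_⟩
  have hpos : 0 < likelihood P₀ β l := likelihood_pos hβΓ l
  rw [hlik] at hpos
  rw [hlik, hlik]
  refine inv_anti₀ (inv_pos.1 hpos) ?_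
  gcongr
  · exact ((hfin β').1 hβ').ne
  · exact hβ β'

end MaxLikelihood

/-! ### Determination of measures by moments -/

section Moments

open scoped BoundedContinuousFunction

/-- A finite measure on a countable power of the unit interval is determined by its moments. -/
lemma measure_ext_of_moments {ι : Type*} [Countable ι]
    {μ ν : Measure (ι → Set.Icc (0 : ℝ) 1)} [IsFiniteMeasure μ] [IsFiniteMeasure ν]
    (h : ∀ s : List ι, ∫ t, (s.map fun i => (t i : ℝ)).prod ∂μ =
      ∫ t, (s.map fun i => (t i : ℝ)).prod ∂ν) : μ = ν := by
  let coord : ι → (ι → Set.Icc (0 : ℝ) 1) →ᵇ ℝ := fun i =>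
    BoundedContinuousFunction.mkOfCompact ⟨fun t => (t i : ℝ), by fun_prop⟩
  -- Stone–Weierstrass: the coordinates separate points, and the algebra they generate is spanned by
  -- monomials.
  refine ext_of_forall_mem_subalgebra_integral_eq_of_polish (𝕜 := ℝ)
    (A := StarAlgebra.adjoin ℝ (Set.range coord)) ?_ ?_
  · intro t t' htt'
    obtain ⟨i, hi⟩ := Function.ne_iff.1 htt'
    refine ⟨fun t => (t i : ℝ), ⟨_, ⟨coord i, ?_, rfl⟩, rfl⟩, ?_⟩
    · exact StarAlgebra.subset_adjoin _ _ ⟨i, rfl⟩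
    · exact fun h => hi (Subtype.ext h)
  · intro g hg
    have hstar : star (Set.range coord) = Set.range coord := by
      have : ∀ f : (ι → Set.Icc (0 : ℝ) 1) →ᵇ ℝ, star f = f := fun f => by
        ext t
        simp
      ext f
      simp [Set.mem_star, this]
    have hg' : g ∈ Submodule.span ℝ
        (Submonoid.closure (Set.range coord) : Set ((ι → Set.Icc (0 : ℝ) 1) →ᵇ ℝ)) := by
      rw [← Algebra.adjoin_eq_span]
      have h1 := StarAlgebra.adjoin_toSubalgebra ℝ (Set.range coord)
      rw [hstar, Set.union_self] at h1
      rw [← h1]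
      exact hg
    clear hg
    induction hg' using Submodule.span_induction with
    | mem f hf =>
      have : ∃ s : List ι, f = (s.map coord).prod := by
        induction hf using Submonoid.closure_induction with
        | mem f hf =>
          obtain ⟨i, rfl⟩ := hf
          exact ⟨[i], by simp⟩
        | one => exact ⟨[], rfl⟩
        | mul a b _ _ ha hb =>
          obtain ⟨s, rfl⟩ := ha
          obtain ⟨s', rfl⟩ := hb
          exact ⟨s ++ s', by simp⟩
      obtain ⟨s, rfl⟩ := this
      have happ : ∀ t, (s.map coord).prod t = (s.map fun i => (t i : ℝ)).prod := by
        intro t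
        clear hf
        induction s with
        | nil => simp
        | cons i s ih =>
          simp only [List.map_cons, List.prod_cons, BoundedContinuousFunction.mul_apply, ih]
          rfl
      simp only [happ]
      exact h s
    | zero => simp
    | add a b _ _ ha hb =>
      simp only [BoundedContinuousFunction.add_apply]
      rw [integral_add (a.integrable μ) (b.integrable μ),
        integral_add (a.integrable ν) (b.integrable ν), ha, hb]
    | smul r a _ ha =>
      simp only [BoundedContinuousFunction.coe_smul]
      rw [integral_smul, integral_smul, ha]

/-- Finite measures that agree on the products of a countable family of functions into `[0, 1]`
agree on the `σ`-algebra generated by the family. -/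
lemma lintegral_eq_of_lintegral_prod_eq {Ω ι : Type*} [MeasurableSpace Ω] [Countable ι]
    {μ ν : Measure Ω} [IsFiniteMeasure μ] [IsFiniteMeasure ν] {h : ι → Ω → ℝ≥0∞}
    (hm : ∀ i, Measurable (h i)) (hle : ∀ i ω, h i ω ≤ 1)
    (heq : ∀ s : List ι, ∫⁻ ω, (s.map fun i => h i ω).prod ∂μ =
      ∫⁻ ω, (s.map fun i => h i ω).prod ∂ν)
    {G : Ω → ℝ≥0∞} (hG : Measurable[⨆ i, MeasurableSpace.comap (h i) inferInstance] G) :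
    ∫⁻ ω, G ω ∂μ = ∫⁻ ω, G ω ∂ν := by
  let T : Ω → ι → Set.Icc (0 : ℝ) 1 := fun ω i =>
    ⟨(h i ω).toReal, ENNReal.toReal_nonneg, by
      simpa using ENNReal.toReal_mono ENNReal.one_ne_top (hle i ω)⟩
  have hT : Measurable T := by
    refine measurable_pi_lambda _ fun i => Measurable.subtype_mk ?_
    exact (hm i).ennreal_toReal
  have hmap : μ.map T = ν.map T := by
    refine measure_ext_of_moments fun s => ?_
    have hmeas : Measurable fun t : ι → Set.Icc (0 : ℝ) 1 => (s.map fun i => (t i : ℝ)).prod := by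
      induction s with
      | nil => simp
      | cons i s ih =>
        simp only [List.map_cons, List.prod_cons]
        exact (measurable_subtype_coe.comp (measurable_pi_apply i)).mul ih
    have hcomp : ∀ ω, (s.map fun i => (T ω i : ℝ)).prod = (s.map fun i => h i ω).prod.toReal := by
      intro ω
      clear hmeas
      induction s with
      | nil => simp
      | cons i s ih => simp only [List.map_cons, List.prod_cons, ENNReal.toReal_mul, ih]; rfl
    have hms : Measurable fun ω => (s.map fun i => h i ω).prod := by
      clear hmeas hcomp
      induction s with
      | nil => simp
      | cons i s ih =>
        simp only [List.map_cons, List.prod_cons]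
        exact (hm i).mul ih
    have htop : ∀ ω, (s.map fun i => h i ω).prod < ∞ := by
      intro ω
      clear hmeas hcomp hms
      induction s with
      | nil => simp
      | cons i s ih =>
        simp only [List.map_cons, List.prod_cons]
        exact ENNReal.mul_lt_top ((hle i ω).trans_lt ENNReal.one_lt_top) ih
    rw [integral_map hT.aemeasurable hmeas.aestronglyMeasurable,
      integral_map hT.aemeasurable hmeas.aestronglyMeasurable]
    simp only [hcomp]
    rw [integral_toReal hms.aemeasurable (ae_of_all _ htop),
      integral_toReal hms.aemeasurable (ae_of_all _ htop), heq s]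
  have hle' : (⨆ i, MeasurableSpace.comap (h i) inferInstance) ≤
      MeasurableSpace.comap T inferInstance := by
    refine iSup_le fun i => ?_
    have hi : h i = (fun t : ι → Set.Icc (0 : ℝ) 1 => ENNReal.ofReal (t i)) ∘ T := by
      ext ω
      simp [T, ENNReal.ofReal_toReal ((hle i ω).trans_lt ENNReal.one_lt_top).ne]
    rw [hi, ← MeasurableSpace.comap_comp]
    refine MeasurableSpace.comap_mono (Measurable.comap_le ?_)
    exact (measurable_subtype_coe.comp (measurable_pi_apply i)).ennreal_ofReal
  have hG' : Measurable[MeasurableSpace.comap T inferInstance] G := hG.mono hle' le_rfl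
  -- Equal laws of T mean equal measures on the σ-algebra generated by T, for which G is measurable.
  have htrim : μ.trim hT.comap_le = ν.trim hT.comap_le := by
    refine @Measure.ext _ (MeasurableSpace.comap T inferInstance) _ _ fun S hS => ?_
    rw [trim_measurableSet_eq _ hS, trim_measurableSet_eq _ hS]
    obtain ⟨B, hB, rfl⟩ := hS
    rw [← Measure.map_apply hT hB, ← Measure.map_apply hT hB, hmap]
  rw [← lintegral_trim hT.comap_le hG', htrim, lintegral_trim hT.comap_le hG']

end Moments

/-! ### Posteriors and predictive densities -/

section Posterior

variable {d : ℕ} {P₀ η : Measure (Vec d)}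

lemma priorIntegral_perm {a b : List (Vec d)} (h : a.Perm b) :
    priorIntegral P₀ η a = priorIntegral P₀ η b := by
  simp only [priorIntegral, likelihood_perm _ h]

lemma Conditionable.perm {a b : List (Vec d)} (ha : Conditionable P₀ η a) (h : a.Perm b) :
    Conditionable P₀ η b := by
  refine ⟨fun x hx => ha.1 x (h.mem_iff.2 hx), ?_⟩
  rw [← priorIntegral_perm h]
  exact ha.2

/-- The posterior before normalization. -/
noncomputable def weightedPrior (P₀ η : Measure (Vec d)) (l : List (Vec d)) : Measure (Vec d) :=
  η.withDensity fun β => ENNReal.ofReal (likelihood P₀ β l)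

lemma posterior_eq (l : List (Vec d)) :
    posterior P₀ η l = (priorIntegral P₀ η l)⁻¹ • weightedPrior P₀ η l := rfl

lemma weightedPrior_univ (l : List (Vec d)) :
    weightedPrior P₀ η l Set.univ = priorIntegral P₀ η l := by
  rw [weightedPrior, withDensity_apply _ MeasurableSet.univ, Measure.restrict_univ, priorIntegral]

lemma Conditionable.isFiniteMeasure_weightedPrior {l : List (Vec d)} (h : Conditionable P₀ η l) :
    IsFiniteMeasure (weightedPrior P₀ η l) :=
  ⟨by rw [weightedPrior_univ]; exact h.2.2⟩

lemma Conditionable.isProbabilityMeasure_posterior {l : List (Vec d)}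
    (h : Conditionable P₀ η l) : IsProbabilityMeasure (posterior P₀ η l) :=
  ⟨by
    rw [posterior_eq, Measure.smul_apply, weightedPrior_univ, smul_eq_mul]
    exact ENNReal.inv_mul_cancel h.2.1.ne' h.2.2.ne⟩

lemma ae_weightedPrior (hη : η (canonicalSpace P₀)ᶜ = 0) (l : List (Vec d)) :
    ∀ᵐ β ∂(weightedPrior P₀ η l), β ∈ canonicalSpace P₀ :=
  (withDensity_absolutelyContinuous _ _) hη

lemma ae_posterior (hη : η (canonicalSpace P₀)ᶜ = 0) (l : List (Vec d)) :
    ∀ᵐ β ∂(posterior P₀ η l), β ∈ canonicalSpace P₀ := by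
  rw [posterior_eq]
  exact Measure.ae_smul_measure (ae_weightedPrior hη l) _

variable [SFinite P₀]

lemma lintegral_weightedPrior (l : List (Vec d)) {g : Vec d → ℝ≥0∞} (hg : Measurable g) :
    ∫⁻ β, g β ∂(weightedPrior P₀ η l) =
      ∫⁻ β, ENNReal.ofReal (likelihood P₀ β l) * g β ∂η := by
  rw [weightedPrior, lintegral_withDensity_eq_lintegral_mul _
    (measurable_likelihood l).ennreal_ofReal hg]
  rfl

lemma lintegral_weightedPrior_append (l : List (Vec d)) (x : Vec d) {g : Vec d → ℝ≥0∞}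
    (hg : Measurable g) :
    ∫⁻ β, g β ∂(weightedPrior P₀ η (l ++ [x])) =
      ∫⁻ β, ENNReal.ofReal (density P₀ β x) * g β ∂(weightedPrior P₀ η l) := by
  rw [lintegral_weightedPrior _ hg,
    lintegral_weightedPrior (g := fun β => ENNReal.ofReal (density P₀ β x) * g β) _
      ((measurable_density_param x).ennreal_ofReal.mul hg)]
  refine lintegral_congr fun β => ?_
  rw [likelihood_append, ENNReal.ofReal_mul (likelihood_nonneg _ _), mul_assoc]
  simp [likelihood]

lemma predictiveDensity_eq (l : List (Vec d)) (x : Vec d) :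
    predictiveDensity P₀ η l x =
      (priorIntegral P₀ η l)⁻¹ * priorIntegral P₀ η (l ++ [x]) := by
  rw [predictiveDensity, posterior_eq, lintegral_smul_measure, smul_eq_mul,
    ← weightedPrior_univ (l ++ [x]), ← lintegral_one, lintegral_weightedPrior_append _ _ (by simp)]
  simp

lemma Conditionable.measurable_predictiveDensity {l : List (Vec d)} (h : Conditionable P₀ η l) :
    Measurable (predictiveDensity P₀ η l) := by
  have := h.isProbabilityMeasure_posterior
  exact measurable_density.ennreal_ofReal.lintegral_prod_left'

lemma Conditionable.lintegral_predictiveDensity [NeZero P₀] {l : List (Vec d)}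
    (h : Conditionable P₀ η l) (hη : η (canonicalSpace P₀)ᶜ = 0) :
    ∫⁻ x, predictiveDensity P₀ η l x ∂P₀ = 1 := by
  have := h.isProbabilityMeasure_posterior
  unfold predictiveDensity
  rw [lintegral_lintegral_swap]
  · calc ∫⁻ β, ∫⁻ x, ENNReal.ofReal (density P₀ β x) ∂P₀ ∂(posterior P₀ η l)
        = ∫⁻ _, 1 ∂(posterior P₀ η l) := by
          refine lintegral_congr_ae ?_
          filter_upwards [ae_posterior hη l] with β hβ
          exact lintegral_density hβ
      _ = 1 := by simp
  · exact (measurable_density.comp measurable_swap).ennreal_ofReal.aemeasurable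

/-- The bound on the likelihood of b preserves finiteness, and its positivity on Γ preserves
positivity. -/
lemma Conditionable.append [NeZero P₀] {a b : List (Vec d)} (ha : Conditionable P₀ η a)
    (hη : η (canonicalSpace P₀)ᶜ = 0) (hb : ∀ x ∈ b, x ∈ P₀.support) {C : ℝ}
    (hC : ∀ β ∈ canonicalSpace P₀, likelihood P₀ β b ≤ C) : Conditionable P₀ η (a ++ b) := by
  have hη' : ∀ᵐ β ∂η, β ∈ canonicalSpace P₀ := hη
  refine ⟨fun x hx => (List.mem_append.1 hx).elim (ha.1 x) (hb x), ?_, ?_⟩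
  · rw [pos_iff_ne_zero]
    intro h0
    rw [priorIntegral, lintegral_eq_zero_iff (measurable_likelihood _).ennreal_ofReal] at h0
    refine ha.2.1.ne' ?_
    rw [priorIntegral, lintegral_eq_zero_iff (measurable_likelihood _).ennreal_ofReal]
    filter_upwards [h0, hη'] with β hβ hβΓ
    have := mul_pos (likelihood_pos hβΓ a) (likelihood_pos hβΓ b)
    rw [← likelihood_append] at this
    simp only [Pi.zero_apply, ENNReal.ofReal_eq_zero] at hβ
    exact absurd hβ (not_le.2 this)
  · calc priorIntegral P₀ η (a ++ b)
        ≤ ∫⁻ β, ENNReal.ofReal (likelihood P₀ β a) * ENNReal.ofReal C ∂η := by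
          refine lintegral_mono_ae ?_
          filter_upwards [hη'] with β hβ
          rw [likelihood_append, ENNReal.ofReal_mul (likelihood_nonneg _ _)]
          gcongr
          exact hC β hβ
      _ = priorIntegral P₀ η a * ENNReal.ofReal C :=
          lintegral_mul_const _ (measurable_likelihood a).ennreal_ofReal
      _ < ∞ := ENNReal.mul_lt_top ha.2.2 ENNReal.ofReal_lt_top

end Posterior

/-! ### Recovering a system from its predictions -/

section Recovery

variable {d : ℕ} {P₀ : Measure (Vec d)}

/-- The probability of the event `B` under the element of the family with parameter `β`. -/
noncomputable def outcomeProb (P₀ : Measure (Vec d)) (B : Set (Vec d)) (β : Vec d) : ℝ≥0∞ :=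
  ∫⁻ x in B, ENNReal.ofReal (density P₀ β x) ∂P₀

lemma measurable_outcomeProb [SFinite P₀] (B : Set (Vec d)) : Measurable (outcomeProb P₀ B) :=
  measurable_density.ennreal_ofReal.lintegral_prod_right'

lemma outcomeProb_le_one [IsProbabilityMeasure P₀] (B : Set (Vec d)) (β : Vec d) :
    outcomeProb P₀ B β ≤ 1 := by
  refine (setLIntegral_le_lintegral _ _).trans ?_
  by_cases hβ : β ∈ canonicalSpace P₀
  · exact (lintegral_density hβ).le
  -- Outside Γ, `toReal` turns Z = ∞ into 0, and division by 0 makes the density 0.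
  · have : partitionFn P₀ β = ∞ := by simpa [canonicalSpace] using hβ
    simp [density, this]

/-- Continuity gives the limit at every support point, not merely almost everywhere; this lets
predictions known almost everywhere determine densities at given points. -/
lemma tendsto_setLIntegral_ball_div [IsFiniteMeasure P₀] {f : Vec d → ℝ≥0∞} (hf : Continuous f)
    {x : Vec d} (hx : x ∈ P₀.support) :
    Tendsto (fun j : ℕ => (∫⁻ y in Metric.ball x (1 / (j + 1)), f y ∂P₀) /
      P₀ (Metric.ball x (1 / (j + 1)))) atTop (𝓝 (f x)) := by
  have hpos : ∀ j : ℕ, P₀ (Metric.ball x (1 / (j + 1))) ≠ 0 := fun j =>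
    ((Measure.mem_support_iff_forall _).1 hx _ (Metric.ball_mem_nhds _ (by positivity))).ne'
  have hball : ∀ U ∈ 𝓝 x, ∀ᶠ j : ℕ in atTop, Metric.ball x (1 / (j + 1)) ⊆ U := by
    intro U hU
    obtain ⟨r, hr, hrU⟩ := Metric.mem_nhds_iff.1 hU
    filter_upwards [tendsto_one_div_add_atTop_nhds_zero_nat.eventually (gt_mem_nhds hr)] with j hj
    exact (Metric.ball_subset_ball hj.le).trans hrU
  refine tendsto_order.2 ⟨fun a ha => ?_, fun a ha => ?_⟩
  · obtain ⟨b, hab, hb⟩ := exists_between ha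
    filter_upwards [hball _ (hf.tendsto x (lt_mem_nhds hb))] with j hj
    refine hab.trans_le ?_
    rw [ENNReal.le_div_iff_mul_le (.inl (hpos j)) (.inl (measure_ne_top _ _)),
      ← setLIntegral_const]
    exact setLIntegral_mono' measurableSet_ball fun y hy => (hj hy).le
  · obtain ⟨b, hb, hab⟩ := exists_between ha
    filter_upwards [hball _ (hf.tendsto x (gt_mem_nhds hb))] with j hj
    refine lt_of_le_of_lt ?_ hab
    refine ENNReal.div_le_of_le_mul ?_
    rw [← setLIntegral_const]
    exact setLIntegral_mono' measurableSet_ball fun y hy => (hj hy).le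

variable [IsProbabilityMeasure P₀]

/-- Tonelli: a factor P_β(B) is traded for one more outcome averaged over B. -/
lemma lintegral_weightedPrior_outcomeProb_mul {η : Measure (Vec d)} {l : List (Vec d)}
    (h : Conditionable P₀ η l) (B : Set (Vec d)) {g : Vec d → ℝ≥0∞} (hg : Measurable g) :
    ∫⁻ β, outcomeProb P₀ B β * g β ∂(weightedPrior P₀ η l) =
      ∫⁻ x in B, ∫⁻ β, g β ∂(weightedPrior P₀ η (l ++ [x])) ∂P₀ := by
  have := h.isFiniteMeasure_weightedPrior
  simp_rw [lintegral_weightedPrior_append l _ hg]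
  rw [lintegral_lintegral_swap]
  · refine lintegral_congr fun β => ?_
    rw [outcomeProb, lintegral_mul_const]
    exact (continuous_density β).measurable.ennreal_ofReal
  · exact ((measurable_density.comp measurable_swap).ennreal_ofReal.mul
      (hg.comp measurable_snd)).aemeasurable

lemma measurable_list_prod_outcomeProb (Bs : List (Set (Vec d))) :
    Measurable fun β => (Bs.map fun B => outcomeProb P₀ B β).prod := by
  induction Bs with
  | nil => simp
  | cons B Bs ih =>
    simp only [List.map_cons, List.prod_cons]
    exact (measurable_outcomeProb B).mul ih

/-- If the predictions of two priors agree at all extensions of `a`, then so do the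
probabilities of all products of events under the posteriors at `a`. -/
lemma lintegral_list_prod_outcomeProb_eq {η₁ η₂ : Measure (Vec d)} {a : List (Vec d)}
    {c₁ c₂ : ℝ≥0∞}
    (h₁ : ∀ b : List (Vec d), (∀ x ∈ b, x ∈ P₀.support) → Conditionable P₀ η₁ (a ++ b))
    (h₂ : ∀ b : List (Vec d), (∀ x ∈ b, x ∈ P₀.support) → Conditionable P₀ η₂ (a ++ b))
    (heq : ∀ b : List (Vec d), (∀ x ∈ b, x ∈ P₀.support) →
      predictiveDensity P₀ η₁ (a ++ b) =ᵐ[P₀] predictiveDensity P₀ η₂ (a ++ b))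
    (Bs : List (Set (Vec d))) (b : List (Vec d)) (hb : ∀ x ∈ b, x ∈ P₀.support)
    (hab : c₁ * priorIntegral P₀ η₁ (a ++ b) = c₂ * priorIntegral P₀ η₂ (a ++ b)) :
    c₁ * ∫⁻ β, (Bs.map fun B => outcomeProb P₀ B β).prod ∂(weightedPrior P₀ η₁ (a ++ b)) =
      c₂ * ∫⁻ β, (Bs.map fun B => outcomeProb P₀ B β).prod ∂(weightedPrior P₀ η₂ (a ++ b)) := by
  -- Each event is traded for one more outcome x. The hypothesis `hab` passes to b ++ [x] for almost
  -- every x because the predictions agree there.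
  induction Bs generalizing b with
  | nil => simpa [weightedPrior_univ] using hab
  | cons B Bs ih =>
    simp only [List.map_cons, List.prod_cons]
    have hm := measurable_list_prod_outcomeProb (P₀ := P₀) Bs
    rw [lintegral_weightedPrior_outcomeProb_mul (h₁ b hb) B hm,
      lintegral_weightedPrior_outcomeProb_mul (h₂ b hb) B hm]
    have hmeas : ∀ η : Measure (Vec d), Conditionable P₀ η (a ++ b) → Measurable fun x =>
        ∫⁻ β, (Bs.map fun B => outcomeProb P₀ B β).prod ∂(weightedPrior P₀ η (a ++ b ++ [x])) := by
      intro η h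
      have := h.isFiniteMeasure_weightedPrior
      simp_rw [lintegral_weightedPrior_append _ _ hm]
      exact Measurable.lintegral_prod_left'
        (f := fun p : Vec d × Vec d => ENNReal.ofReal (density P₀ p.1 p.2) *
          (Bs.map fun B => outcomeProb P₀ B p.1).prod)
        (measurable_density.ennreal_ofReal.mul (hm.comp measurable_fst))
    rw [← lintegral_const_mul _ (hmeas _ (h₁ b hb)), ← lintegral_const_mul _ (hmeas _ (h₂ b hb))]
    refine lintegral_congr_ae (ae_restrict_of_ae ?_)
    filter_upwards [heq b hb, Measure.support_mem_ae (μ := P₀)] with x hx hxs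
    have hbx : ∀ y ∈ b ++ [x], y ∈ P₀.support := by
      intro y hy
      rcases List.mem_append.1 hy with hy | hy
      · exact hb y hy
      · rw [List.mem_singleton.1 hy]
        exact hxs
    have := ih (b ++ [x]) hbx
    rw [← List.append_assoc] at this
    refine this ?_
    rw [predictiveDensity_eq, predictiveDensity_eq] at hx
    have h1 := (h₁ b hb).2
    have h2 := (h₂ b hb).2
    calc c₁ * priorIntegral P₀ η₁ (a ++ b ++ [x])
        = (c₁ * priorIntegral P₀ η₁ (a ++ b)) *
            ((priorIntegral P₀ η₁ (a ++ b))⁻¹ * priorIntegral P₀ η₁ (a ++ b ++ [x])) := by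
          rw [mul_assoc, ENNReal.mul_inv_cancel_left h1.1.ne' h1.2.ne]
      _ = c₂ * priorIntegral P₀ η₂ (a ++ b ++ [x]) := by
          rw [hab, hx, mul_assoc, ENNReal.mul_inv_cancel_left h2.1.ne' h2.2.ne]

/-- If the predictions of two priors agree at all extensions of `a`, then their prior integrals
are proportional. -/
lemma inv_mul_priorIntegral_eq {η₁ η₂ : Measure (Vec d)} {a : List (Vec d)}
    (hη₁ : η₁ (canonicalSpace P₀)ᶜ = 0) (hη₂ : η₂ (canonicalSpace P₀)ᶜ = 0)
    (h₁ : ∀ b : List (Vec d), (∀ x ∈ b, x ∈ P₀.support) → Conditionable P₀ η₁ (a ++ b))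
    (h₂ : ∀ b : List (Vec d), (∀ x ∈ b, x ∈ P₀.support) → Conditionable P₀ η₂ (a ++ b))
    (heq : ∀ b : List (Vec d), (∀ x ∈ b, x ∈ P₀.support) →
      predictiveDensity P₀ η₁ (a ++ b) =ᵐ[P₀] predictiveDensity P₀ η₂ (a ++ b))
    {l : List (Vec d)} (hl : ∀ x ∈ l, x ∈ P₀.support) :
    (priorIntegral P₀ η₁ a)⁻¹ * priorIntegral P₀ η₁ l =
      (priorIntegral P₀ η₂ a)⁻¹ * priorIntegral P₀ η₂ l := by
  have ha₁ : Conditionable P₀ η₁ a := by simpa using h₁ [] (by simp)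
  have ha₂ : Conditionable P₀ η₂ a := by simpa using h₂ [] (by simp)
  have := ha₁.isProbabilityMeasure_posterior
  have := ha₂.isProbabilityMeasure_posterior
  let S : Set (Vec d) := {x | x ∈ l ++ a}
  have : Countable S := (List.finite_toSet (l ++ a)).countable.to_subtype
  let h : S × ℕ → Vec d → ℝ≥0∞ := fun i => outcomeProb P₀ (Metric.ball i.1 (1 / (i.2 + 1)))
  -- As a limsup of ball probabilities, D is visibly measurable for the σ-algebra they generate.
  let D : Vec d → Vec d → ℝ≥0∞ := fun x β => limsup (fun j : ℕ =>
    outcomeProb P₀ (Metric.ball x (1 / (j + 1))) β / P₀ (Metric.ball x (1 / (j + 1)))) atTop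
  have hD : ∀ x ∈ P₀.support, ∀ β, D x β = ENNReal.ofReal (density P₀ β x) := fun x hx β =>
    (tendsto_setLIntegral_ball_div
      (ENNReal.continuous_ofReal.comp (continuous_density β)) hx).limsup_eq
  have hDprod : ∀ l' : List (Vec d), (∀ x ∈ l', x ∈ P₀.support) → ∀ β,
      (l'.map fun x => D x β).prod = ENNReal.ofReal (likelihood P₀ β l') := by
    intro l' hl' β
    induction l' with
    | nil => simp [likelihood]
    | cons x l' ih =>
      have h1 : likelihood P₀ β (x :: l') = density P₀ β x * likelihood P₀ β l' := by
        simp [likelihood]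
      rw [List.map_cons, List.prod_cons, ih fun y hy => hl' y (List.mem_cons_of_mem _ hy),
        hD x (hl' x List.mem_cons_self), h1, ENNReal.ofReal_mul (density_nonneg _ _)]
  -- The posterior at a already carries the likelihood of a; dividing by it leaves the prior
  -- integral of l, even when l does not extend a.
  let G : Vec d → ℝ≥0∞ := fun β => (l.map fun x => D x β).prod / (a.map fun x => D x β).prod
  have hG : Measurable[⨆ i, MeasurableSpace.comap (h i) inferInstance] G := by
    let m : MeasurableSpace (Vec d) := ⨆ i, MeasurableSpace.comap (h i) inferInstance
    have hDm : ∀ x ∈ l ++ a, Measurable[m] (D x) := by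
      intro x hx
      refine Measurable.limsup fun j => Measurable.div_const ?_ _
      have : Measurable[m] (h (⟨x, hx⟩, j)) :=
        (comap_measurable _).mono (le_iSup (fun i => MeasurableSpace.comap (h i) inferInstance) _)
          le_rfl
      exact this
    have hDprodm : ∀ l' ⊆ l ++ a, Measurable[m] fun β => (l'.map fun x => D x β).prod := by
      intro l' hl'
      induction l' with
      | nil => simp
      | cons x l' ih =>
        simp only [List.map_cons, List.prod_cons]
        exact (hDm x (hl' List.mem_cons_self)).mul
          (ih fun y hy => hl' (List.mem_cons_of_mem _ hy))
    exact (hDprodm l (by simp)).div (hDprodm a (by simp))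
  have hGeq : ∀ β, G β = ENNReal.ofReal (likelihood P₀ β l) / ENNReal.ofReal (likelihood P₀ β a) :=
    fun β => by simp only [G, hDprod l hl, hDprod a ha₁.1]
  have hGmeas : Measurable G := by
    simp_rw [funext hGeq]
    exact (measurable_likelihood l).ennreal_ofReal.div (measurable_likelihood a).ennreal_ofReal
  have hint : ∀ η : Measure (Vec d), η (canonicalSpace P₀)ᶜ = 0 →
      ∫⁻ β, G β ∂(posterior P₀ η a) = (priorIntegral P₀ η a)⁻¹ * priorIntegral P₀ η l := by
    intro η hη
    rw [posterior_eq, lintegral_smul_measure, smul_eq_mul, lintegral_weightedPrior _ hGmeas]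
    congr 1
    have hη' : ∀ᵐ β ∂η, β ∈ canonicalSpace P₀ := hη
    refine lintegral_congr_ae ?_
    filter_upwards [hη'] with β hβ
    rw [hGeq, ENNReal.mul_div_cancel (by simpa using likelihood_pos hβ a) ENNReal.ofReal_ne_top]
  rw [← hint η₁ hη₁, ← hint η₂ hη₂]
  refine lintegral_eq_of_lintegral_prod_eq (h := h) (fun i => measurable_outcomeProb _)
    (fun i β => outcomeProb_le_one _ β) (fun s => ?_) hG
  have := lintegral_list_prod_outcomeProb_eq (c₁ := (priorIntegral P₀ η₁ a)⁻¹)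
    (c₂ := (priorIntegral P₀ η₂ a)⁻¹) h₁ h₂ heq
    (s.map fun i => Metric.ball (i.1 : Vec d) (1 / (i.2 + 1))) [] (by simp) (by
      rw [List.append_nil, ENNReal.inv_mul_cancel ha₁.2.1.ne' ha₁.2.2.ne,
        ENNReal.inv_mul_cancel ha₂.2.1.ne' ha₂.2.2.ne])
  rw [List.append_nil] at this
  simp only [List.map_map] at this
  rw [posterior_eq, posterior_eq, lintegral_smul_measure, lintegral_smul_measure]
  exact this

/-- If the predictions of two systems agree at all extensions of one sequence, then the systems
are the same. -/
theorem PredictionSystem.predict_eq {Q₁ Q₂ : PredictionSystem P₀} {a : List (Vec d)}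
    (h₁ : ∀ b : List (Vec d), (∀ x ∈ b, x ∈ P₀.support) → Conditionable P₀ Q₁.prior (a ++ b))
    (h₂ : ∀ b : List (Vec d), (∀ x ∈ b, x ∈ P₀.support) → Conditionable P₀ Q₂.prior (a ++ b))
    (heq : ∀ b : List (Vec d), (∀ x ∈ b, x ∈ P₀.support) →
      predictiveDensity P₀ Q₁.prior (a ++ b) =ᵐ[P₀] predictiveDensity P₀ Q₂.prior (a ++ b)) :
    Q₁.predict = Q₂.predict := by
  have ha₁ : Conditionable P₀ Q₁.prior a := by simpa using h₁ [] (by simp)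
  have ha₂ : Conditionable P₀ Q₂.prior a := by simpa using h₂ [] (by simp)
  obtain ⟨r, hr0, hrt, hr⟩ : ∃ r : ℝ≥0∞, r ≠ 0 ∧ r ≠ ∞ ∧ ∀ l : List (Vec d),
      (∀ x ∈ l, x ∈ P₀.support) →
        priorIntegral P₀ Q₁.prior l = r * priorIntegral P₀ Q₂.prior l := by
    refine ⟨priorIntegral P₀ Q₁.prior a * (priorIntegral P₀ Q₂.prior a)⁻¹,
      mul_ne_zero ha₁.2.1.ne' (ENNReal.inv_ne_zero.2 ha₂.2.2.ne),
      ENNReal.mul_ne_top ha₁.2.2.ne (ENNReal.inv_ne_top.2 ha₂.2.1.ne'), fun l hl => ?_⟩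
    rw [mul_assoc, ← inv_mul_priorIntegral_eq Q₁.prior_compl Q₂.prior_compl h₁ h₂ heq hl,
      ENNReal.mul_inv_cancel_left ha₁.2.1.ne' ha₁.2.2.ne]
  funext l
  refine Part.ext' ?_ ?_
  · change Conditionable P₀ Q₁.prior l ↔ Conditionable P₀ Q₂.prior l
    unfold Conditionable
    refine and_congr_right fun hl => ?_
    -- A factor other than 0 and ∞ changes neither positivity nor finiteness, so the domains agree.
    rw [hr l hl, pos_iff_ne_zero, pos_iff_ne_zero, lt_top_iff_ne_top, lt_top_iff_ne_top,
      Ne, Ne, Ne, Ne, ENNReal.mul_eq_top, mul_eq_zero]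
    tauto
  · intro h h'
    refine withDensity_congr_ae ?_
    filter_upwards [Measure.support_mem_ae (μ := P₀)] with x hx
    have hlx : ∀ y ∈ l ++ [x], y ∈ P₀.support := by
      intro y hy
      rcases List.mem_append.1 hy with hy | hy
      · exact h.1 y hy
      · rw [List.mem_singleton.1 hy]
        exact hx
    rw [predictiveDensity_eq, predictiveDensity_eq, hr _ hlx, hr l h.1,
      ENNReal.mul_inv (.inl hr0) (.inl hrt), mul_mul_mul_comm, ENNReal.inv_mul_cancel hr0 hrt,
      one_mul]

end Recovery

/-! ### Sequences built step by step -/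

section Sequences

variable {d : ℕ}

lemma initialSegment_succ (x : ℕ → Vec d) (n : ℕ) :
    initialSegment x (n + 1) = initialSegment x n ++ [x n] := by
  simp [initialSegment, List.range_succ]

/-- A list can be continued to a sequence by a rule that gives each next term. -/
lemma exists_sequence (a : List (Vec d)) (next : List (Vec d) → Vec d) :
    ∃ x : ℕ → Vec d, initialSegment x a.length = a ∧
      ∀ n ≥ a.length, x n = next (initialSegment x n) := by
  let S : ℕ → List (Vec d) := fun k => Nat.rec a (fun _ l => l ++ [next l]) k
  let x : ℕ → Vec d := fun n => if h : n < a.length then a[n] else next (S (n - a.length))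
  have hS : ∀ k, initialSegment x (a.length + k) = S k := by
    intro k
    induction k with
    | zero =>
      refine List.ext_getElem (by simp [initialSegment, S]) fun n h1 h2 => ?_
      have : n < a.length := h2
      simp [initialSegment, x, S, this]
    | succ k ih =>
      rw [← add_assoc, initialSegment_succ, ih]
      simp [x, S]
  refine ⟨x, hS 0, fun n hn => ?_⟩
  obtain ⟨k, rfl⟩ := Nat.exists_eq_add_of_le hn
  rw [hS]
  simp [x]

end Sequences

/-! ### Comparison of regrets -/

section Regret

variable {d : ℕ} {P₀ : Measure (Vec d)}

lemma regret_sub_regret (Q₁ Q₂ : PredictionSystem P₀) (x : ℕ → Vec d) (m n : ℕ)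
    (h₁ : ∀ i ≥ m, 0 < (predictiveDensity P₀ Q₁.prior (initialSegment x i) (x i)).toReal)
    (h₂ : ∀ i ≥ m, 0 < (predictiveDensity P₀ Q₂.prior (initialSegment x i) (x i)).toReal) :
    regret Q₂ x m n - regret Q₁ x m n = ∑ i ∈ Finset.Ico m n,
      (Real.log (predictiveDensity P₀ Q₁.prior (initialSegment x i) (x i)).toReal -
        Real.log (predictiveDensity P₀ Q₂.prior (initialSegment x i) (x i)).toReal) := by
  rw [regret, regret, condDensity, condDensity,
    Real.log_prod fun i hi => (h₁ i (Finset.mem_Ico.1 hi).1).ne',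
    Real.log_prod fun i hi => (h₂ i (Finset.mem_Ico.1 hi).1).ne', Finset.sum_sub_distrib]
  ring

variable [IsProbabilityMeasure P₀]

/-- There is a sequence at all of whose extensions both posteriors exist, and which affinely
spans the support. -/
lemma exists_common_conditionable (Q₁ Q₂ : PredictionSystem P₀) :
    ∃ a : List (Vec d), ∀ b : List (Vec d), (∀ x ∈ b, x ∈ P₀.support) →
      Conditionable P₀ Q₁.prior (a ++ b) ∧ Conditionable P₀ Q₂.prior (a ++ b) ∧
        Spanning P₀ (a ++ b) := by
  obtain ⟨l₁, h₁⟩ := Q₁.exists_conditionable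
  obtain ⟨l₂, h₂⟩ := Q₂.exists_conditionable
  obtain ⟨l₀, h₀⟩ := exists_spanning (P₀ := P₀)
  refine ⟨l₁ ++ l₂ ++ l₀, fun b hb => ?_⟩
  -- Everything after l contains the spanning list l₀, so its likelihood is bounded by its maximum.
  -- For Q₂ the order of l₁ and l₂ is then exchanged.
  have key : ∀ (Q : PredictionSystem P₀) (l l' : List (Vec d)), Conditionable P₀ Q.prior l →
      (∀ x ∈ l', x ∈ P₀.support) → Conditionable P₀ Q.prior (l ++ (l' ++ (l₀ ++ b))) := by
    intro Q l l' hl hl'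
    have hsupp : ∀ x ∈ l' ++ (l₀ ++ b), x ∈ P₀.support := by
      simp only [List.mem_append]
      rintro x (hx | hx | hx)
      exacts [hl' x hx, h₀.mem_support x hx, hb x hx]
    obtain ⟨β, -, hβ⟩ := (h₀.mono (b := l' ++ (l₀ ++ b))
      (fun x hx => by simp [hx]) hsupp).exists_isMaxLikelihood
    exact hl.append Q.prior_compl hsupp hβ
  have hc₁ : Conditionable P₀ Q₁.prior (l₁ ++ l₂ ++ l₀ ++ b) := by
    simpa only [List.append_assoc] using key Q₁ l₁ l₂ h₁ h₂.1
  refine ⟨hc₁, ?_, h₀.mono (fun x hx => by simp [hx]) hc₁.1⟩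
  refine (key Q₂ l₂ l₁ h₂ h₁.1).perm ?_
  rw [← List.append_assoc, List.append_assoc (l₁ ++ l₂)]
  exact List.perm_append_comm.append_right _

lemma Conditionable.predictiveDensity_toReal_pos {η : Measure (Vec d)} {l : List (Vec d)}
    {x : Vec d} (hl : Conditionable P₀ η l) (hlx : Conditionable P₀ η (l ++ [x])) :
    0 < (predictiveDensity P₀ η l x).toReal ∧ predictiveDensity P₀ η l x ≠ ∞ := by
  have h : predictiveDensity P₀ η l x ≠ ∞ := by
    rw [predictiveDensity_eq]
    exact ENNReal.mul_ne_top (ENNReal.inv_ne_top.2 hl.2.1.ne') hlx.2.2.ne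
  refine ⟨ENNReal.toReal_pos ?_ h, h⟩
  rw [predictiveDensity_eq]
  exact mul_ne_zero (ENNReal.inv_ne_zero.2 hl.2.2.ne) hlx.2.1.ne'

/-- Otherwise q₁ < q₂ almost everywhere, although both integrals are 1. -/
lemma exists_predictiveDensity_le {Q₁ Q₂ : PredictionSystem P₀} {l : List (Vec d)}
    (h₁ : Conditionable P₀ Q₁.prior l) (h₂ : Conditionable P₀ Q₂.prior l) :
    ∃ x ∈ P₀.support, predictiveDensity P₀ Q₂.prior l x ≤ predictiveDensity P₀ Q₁.prior l x := by
  by_contra! hcon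
  have := lintegral_strict_mono (μ := P₀) (NeZero.ne _)
    h₂.measurable_predictiveDensity.aemeasurable
    (by rw [h₁.lintegral_predictiveDensity Q₁.prior_compl]; simp)
    (by filter_upwards [Measure.support_mem_ae (μ := P₀)] with x hx using hcon x hx)
  rw [h₁.lintegral_predictiveDensity Q₁.prior_compl,
    h₂.lintegral_predictiveDensity Q₂.prior_compl] at this
  exact lt_irrefl _ this

lemma predictiveDensity_ae_eq {Q₁ Q₂ : PredictionSystem P₀} {l : List (Vec d)}
    (h₁ : Conditionable P₀ Q₁.prior l) (h₂ : Conditionable P₀ Q₂.prior l)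
    (hle : ∀ x ∈ P₀.support,
      predictiveDensity P₀ Q₁.prior l x ≤ predictiveDensity P₀ Q₂.prior l x) :
    predictiveDensity P₀ Q₁.prior l =ᵐ[P₀] predictiveDensity P₀ Q₂.prior l := by
  have i₁ := h₁.lintegral_predictiveDensity Q₁.prior_compl
  have i₂ := h₂.lintegral_predictiveDensity Q₂.prior_compl
  refine ae_eq_of_ae_le_of_lintegral_le ?_ (by rw [i₁]; simp)
    h₂.measurable_predictiveDensity.aemeasurable (i₂.trans i₁.symm).le
  filter_upwards [Measure.support_mem_ae (μ := P₀)] with x hx using hle x hx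

end Regret

end ExpFamily

/-! ### The sequence with a persistent gain -/

open ExpFamily in
/-- At each step the sequence is continued by an outcome whose density under the second system
is at most the density under the first. -/
theorem ExpFamily.exists_liminf_regret_sub_pos {d : ℕ} {P₀ : Measure (Vec d)}
    [IsProbabilityMeasure P₀] (Q₁ Q₂ : PredictionSystem P₀) (hne : Q₁.predict ≠ Q₂.predict) :
    ∃ (x : ℕ → Vec d) (m : ℕ),
      (∀ n ≥ m, Conditionable P₀ Q₁.prior (initialSegment x n) ∧
        Conditionable P₀ Q₂.prior (initialSegment x n) ∧
        Spanning P₀ (initialSegment x n)) ∧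
      0 < liminf (fun n : ℕ => ((regret Q₂ x m n - regret Q₁ x m n : ℝ) : EReal)) atTop := by
  classical
  obtain ⟨a, ha⟩ := exists_common_conditionable Q₁ Q₂
  have hstrict : ∃ b : List (Vec d), (∀ x ∈ b, x ∈ P₀.support) ∧ ∃ x ∈ P₀.support,
      predictiveDensity P₀ Q₂.prior (a ++ b) x < predictiveDensity P₀ Q₁.prior (a ++ b) x := by
    by_contra! hcon
    exact hne (PredictionSystem.predict_eq (fun b hb => (ha b hb).1) (fun b hb => (ha b hb).2.1)
      fun b hb => predictiveDensity_ae_eq (ha b hb).1 (ha b hb).2.1 (hcon b hb))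
  obtain ⟨b, hb, z, hz, hlt⟩ := hstrict
  -- The rule plays the strict outcome z at a ++ b and a weakly favourable one later; where a
  -- posterior is missing its value is irrelevant.
  have hnext : ∀ l : List (Vec d), ∃ x, (l = a ++ b → x = z) ∧
      (Conditionable P₀ Q₁.prior l → Conditionable P₀ Q₂.prior l → x ∈ P₀.support ∧
        predictiveDensity P₀ Q₂.prior l x ≤ predictiveDensity P₀ Q₁.prior l x) := by
    intro l
    by_cases hl : l = a ++ b
    · exact ⟨z, fun _ => rfl, fun _ _ => ⟨hz, hl ▸ hlt.le⟩⟩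
    by_cases hc : Conditionable P₀ Q₁.prior l ∧ Conditionable P₀ Q₂.prior l
    · obtain ⟨x, hx, hle⟩ := exists_predictiveDensity_le hc.1 hc.2
      exact ⟨x, fun h => absurd h hl, fun _ _ => ⟨hx, hle⟩⟩
    · exact ⟨z, fun _ => rfl, fun h₁ h₂ => absurd ⟨h₁, h₂⟩ hc⟩
  choose next hz' hle using hnext
  obtain ⟨x, hx, hxn⟩ := exists_sequence (a ++ b) next
  set m := (a ++ b).length with hm
  have hseg : ∀ n ≥ m, ∃ b' : List (Vec d), (∀ y ∈ b', y ∈ P₀.support) ∧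
      initialSegment x n = a ++ b' := by
    intro n hn
    induction n, hn using Nat.le_induction with
    | base => exact ⟨b, hb, hx⟩
    | succ n hn ih =>
      obtain ⟨b', hb', heq⟩ := ih
      refine ⟨b' ++ [x n], ?_, by rw [initialSegment_succ, heq, List.append_assoc]⟩
      have hc := ha b' hb'
      intro y hy
      rcases List.mem_append.1 hy with hy | hy
      · exact hb' y hy
      · rw [List.mem_singleton.1 hy, hxn n hn, heq]
        exact (hle _ hc.1 hc.2.1).1
  have hgood : ∀ n ≥ m, Conditionable P₀ Q₁.prior (initialSegment x n) ∧
      Conditionable P₀ Q₂.prior (initialSegment x n) ∧ Spanning P₀ (initialSegment x n) := by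
    intro n hn
    obtain ⟨b', hb', heq⟩ := hseg n hn
    rw [heq]
    exact ha b' hb'
  refine ⟨x, m, hgood, ?_⟩
  have hp₁ : ∀ n ≥ m, 0 < (predictiveDensity P₀ Q₁.prior (initialSegment x n) (x n)).toReal ∧
      predictiveDensity P₀ Q₁.prior (initialSegment x n) (x n) ≠ ∞ := fun n hn =>
    (hgood n hn).1.predictiveDensity_toReal_pos
      (initialSegment_succ x n ▸ (hgood (n + 1) (hn.le.trans n.le_succ)).1)
  have hp₂ : ∀ n ≥ m, 0 < (predictiveDensity P₀ Q₂.prior (initialSegment x n) (x n)).toReal ∧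
      predictiveDensity P₀ Q₂.prior (initialSegment x n) (x n) ≠ ∞ := fun n hn =>
    (hgood n hn).2.1.predictiveDensity_toReal_pos
      (initialSegment_succ x n ▸ (hgood (n + 1) (hn.le.trans n.le_succ)).2.1)
  set gain : ℕ → ℝ := fun i =>
    Real.log (predictiveDensity P₀ Q₁.prior (initialSegment x i) (x i)).toReal -
      Real.log (predictiveDensity P₀ Q₂.prior (initialSegment x i) (x i)).toReal with hgain
  have hgain_nonneg : ∀ i ≥ m, 0 ≤ gain i := by
    intro i hi
    refine sub_nonneg.2 (Real.log_le_log (hp₂ i hi).1 ?_)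
    refine ENNReal.toReal_mono (hp₁ i hi).2 ?_
    have := (hle _ (hgood i hi).1 (hgood i hi).2.1).2
    rwa [← hxn i hi] at this
  have hgain_pos : 0 < gain m := by
    refine sub_pos.2 (Real.log_lt_log (hp₂ m le_rfl).1 ?_)
    refine ENNReal.toReal_strict_mono (hp₁ m le_rfl).2 ?_
    rw [hxn m le_rfl, hx, hz' _ rfl]
    exact hlt
  -- The strict outcome z is x m, which enters the sum only from n = m + 1 on.
  have hbound : ∀ n ≥ m + 1, ((gain m : ℝ) : EReal) ≤
      ((regret Q₂ x m n - regret Q₁ x m n : ℝ) : EReal) := by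
    intro n hn
    rw [EReal.coe_le_coe_iff,
      regret_sub_regret Q₁ Q₂ x m n (fun i hi => (hp₁ i hi).1) (fun i hi => (hp₂ i hi).1)]
    exact Finset.single_le_sum (f := gain) (fun i hi => hgain_nonneg i (Finset.mem_Ico.1 hi).1)
      (Finset.mem_Ico.2 ⟨le_rfl, hn⟩)
  refine lt_of_lt_of_le (EReal.coe_pos.2 hgain_pos) ?_
  exact le_liminf_of_le (by isBoundedDefault) (eventually_atTop.2 ⟨m + 1, hbound⟩)

theorem mainTheorem4 {d : ℕ} (P₀ : Measure (ExpFamily.Vec d)) [IsProbabilityMeasure P₀]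
    (hΓ : (interior (ExpFamily.canonicalSpace P₀)).Nonempty)
    (Q₁ Q₂ : ExpFamily.PredictionSystem P₀) (hne : Q₁.predict ≠ Q₂.predict) :
    ∃ (x : ℕ → ExpFamily.Vec d) (m : ℕ),
      (∀ n ≥ m, (Q₁.predict (ExpFamily.initialSegment x n)).Dom ∧
        (Q₂.predict (ExpFamily.initialSegment x n)).Dom ∧
        ∃ β, ExpFamily.IsMaxLikelihood P₀ (ExpFamily.initialSegment x n) β) ∧
      0 < liminf (fun n : ℕ =>
        ((ExpFamily.regret Q₂ x m n - ExpFamily.regret Q₁ x m n : ℝ) : EReal)) atTop := by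
  obtain ⟨x, m, hgood, hlim⟩ := ExpFamily.exists_liminf_regret_sub_pos Q₁ Q₂ hne
  exact ⟨x, m, fun n hn => ⟨(hgood n hn).1, (hgood n hn).2.1,
    (hgood n hn).2.2.exists_isMaxLikelihood⟩, hlim⟩
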